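/- All spaces are Hausdorff and crowded (that is, without isolated points). For a space $X$, a set $R\subseteq X$ is regular open if $R=\operatorname{int}(\overline{R})$. A set $\mathfrak F$ of pairwise disjoint families of non-empty regular open subsets of $X$ is a *shattering family* for $X$ if for every non-empty open $U\subseteq X$ there is $\mathcal S\in\mathfrak F$ such that $U$ intersects at least two members of $\mathcal S$; the *shattering number* $\operatorname{sh}(X)$ is the least cardinality of a shattering family for $X$. The space $X$ is *feebly compact* if every locally finite family of open subsets of $X$ is finite; *$\pi$-regular* if every non-empty open set $U$ contains $\overline V$ for some non-empty open set $V$; *$k$-separable* if it has a $\sigma$-compact dense subset; and *densely $k$-separable* if every dense subspace of $X$ is $k$-separable. It is *pseudocompact* if it is Tychonoff and every continuous real-valued function on it is bounded. A continuous map $f:X\to Y$ is *nowhere constant* if $|f[U]|>1$ for every non-empty open $U\subseteq X$. **Theorem.** If $X$ is a non-empty feebly compact, $\pi$-regular, densely $k$-separable (crowded Hausdorff) space, then $\operatorname{sh}(X)=\omega$. Consequently, every pseudocompact, densely $k$-separable (crowded) space $X$ has a compact metrizable nowhere constant image, i.e. there are a compact metrizable (crowded) space $Y$ and a nowhere constant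 continuous surjection $f:X\to Y$. -/

import Mathlib

open Set Topology Cardinal

universe u

/-- `X` is π-regular: every non-empty open set contains the closure of a non-empty open set.
(The Hausdorff axiom is assumed separately.) -/
def PiRegular (X : Type u) [TopologicalSpace X] : Prop :=
  ∀ U : Set X, IsOpen U → U.Nonempty → ∃ V : Set X, IsOpen V ∧ V.Nonempty ∧ closure V ⊆ U

/-- `X` is feebly compact: every locally finite family of open sets is finite. -/
def FeeblyCompact (X : Type u) [TopologicalSpace X] : Prop :=
  ∀ 𝒰 : Set (Set X), (∀ U ∈ 𝒰, IsOpen U) → LocallyFinite (fun U : 𝒰 => (U : Set X)) → 𝒰.Finite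

/-- Every continuous real-valued function on `X` is bounded.
(Complete regularity is assumed separately.) -/
def Pseudocompact (X : Type u) [TopologicalSpace X] : Prop :=
  ∀ f : X → ℝ, Continuous f → Bornology.IsBounded (range f)

/-- `X` is `k`-separable: it has a σ-compact dense subset. -/
def KSeparable (X : Type u) [TopologicalSpace X] : Prop :=
  ∃ S : Set X, IsSigmaCompact S ∧ Dense S

/-- `X` is densely `k`-separable: every dense subspace of `X` is `k`-separable. -/
def DenselyKSeparable (X : Type u) [TopologicalSpace X] : Prop :=
  ∀ D : Set X, Dense D → KSeparable D

/-- The collection of all non-empty regular open subsets of `X`. -/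
def regularOpens (X : Type u) [TopologicalSpace X] : Set (Set X) :=
  {R | interior (closure R) = R ∧ R.Nonempty}

/-- The collection of all (pairwise) disjoint families of non-empty regular open subsets of `X`. -/
def cellularFamilies (X : Type u) [TopologicalSpace X] : Set (Set (Set X)) :=
  {𝒮 | 𝒮 ⊆ regularOpens X ∧ 𝒮.PairwiseDisjoint id}

/-- A collection `𝔉` of disjoint families of non-empty regular open sets is shattering if every
non-empty open set meets at least two members of some family in `𝔉`. -/
def IsShatteringFamily {X : Type u} [TopologicalSpace X] (𝔉 : Set (Set (Set X))) : Prop :=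
  𝔉 ⊆ cellularFamilies X ∧
    ∀ U : Set X, IsOpen U → U.Nonempty → ∃ 𝒮 ∈ 𝔉, ∃ S ∈ 𝒮, ∃ T ∈ 𝒮,
      S ≠ T ∧ (U ∩ S).Nonempty ∧ (U ∩ T).Nonempty

/-- The shattering number of `X`: the least cardinality of a shattering family for `X`. -/
noncomputable def shatteringNumber (X : Type u) [TopologicalSpace X] : Cardinal.{u} :=
  sInf {κ | ∃ 𝔉 : Set (Set (Set X)), IsShatteringFamily 𝔉 ∧ #𝔉 = κ}

/-- A map is nowhere constant if it is continuous and its image of every non-empty open set has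
more than one point. -/
def IsNowhereConstant {X Y : Type u} [TopologicalSpace X] [TopologicalSpace Y] (f : X → Y) : Prop :=
  Continuous f ∧ ∀ U : Set X, IsOpen U → U.Nonempty → (f '' U).Nontrivial

/-! Everything rests on a dense meager set `⋃ n, N n` in `X`. Take compact sets `K n` with dense
union and let `G` be the union of their interiors. Off `closure G` the `K n` are nowhere dense.
Inside `G`, local compactness gives resolvability: some subset of `G` and its complement are both
dense in `G`, so compact subsets of the former have empty interior, and dense `k`-separability
supplies countably many with union dense in `G`.

For each `n`, take a maximal disjoint family of open sets with closures missing `N n`. An open set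
meeting only one member lies in the closure of that member, hence misses `N n`; since every
non-empty open set meets some `N n`, the regularized families shatter. Finitely many families never
do.

In the Tychonoff case the members are cozero sets. The families are countable, so the diagonal of
the associated functions maps into a metrizable cube, and pseudocompactness makes the image closed.
-/

/-! ### Splitting many large sets by transfinite choice -/

theorem exists_injective_forall_mem {J X : Type u} (B : J → Set X) (hB : ∀ j, #J ≤ #(B j)) :
    ∃ g : J → X, Function.Injective g ∧ ∀ j, g j ∈ B j := by
  -- In a well-order of least type, fewer than `#J` points are excluded at each stage.
  obtain ⟨_, _, hord⟩ := exists_ord_eq_type_lt J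
  have step : ∀ (j : J) (h : ∀ k, k < j → X), ∃ x ∈ B j, ∀ k (hk : k < j), x ≠ h k hk := by
    intro j h
    by_contra! hcon
    have hsub : B j ⊆ range (fun k : Iio j => h k.1 k.2) := by
      intro x hx
      obtain ⟨k, hk, rfl⟩ := hcon x hx
      exact ⟨⟨k, hk⟩, rfl⟩
    have hlt : #(Iio j) < #J := mk_Iio_lt j hord
    exact absurd ((hB j).trans ((mk_le_mk_of_subset hsub).trans mk_range_le)) hlt.not_ge
  choose F hFB hFne using step
  let g : J → X := (wellFounded_lt (α := J)).fix F
  have hg : ∀ j, g j = F j (fun k _ => g k) := fun j => WellFounded.fix_eq _ _ _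
  refine ⟨g, ?_, fun j => by rw [hg]; exact hFB _ _⟩
  have hne : ∀ j k, k < j → g j ≠ g k := by
    intro j k hk
    rw [hg j]
    exact hFne j _ k hk
  intro a b hab
  rcases lt_trichotomy a b with h | h | h
  · exact absurd hab.symm (hne _ _ h)
  · exact h
  · exact absurd hab (hne _ _ h)

/-- Two distinct points are picked from each `B i`, all choices being distinct; `D` keeps one of
each pair. -/
theorem exists_splitting_set {ι X : Type u} (B : ι → Set X) (κ : Cardinal.{u}) (hκ : ℵ₀ ≤ κ)
    (hι : #ι ≤ κ) (hB : ∀ i, κ ≤ #(B i)) :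
    ∃ D : Set X, ∀ i, (B i ∩ D).Nonempty ∧ (B i \ D).Nonempty := by
  have hcard : #(ι × ULift.{u} Bool) ≤ κ := by
    rw [mk_prod]
    simp only [lift_id, mk_fintype]
    exact mul_le_of_le hκ hι (by simpa using (natCast_lt_aleph0 (n := 2)).le.trans hκ)
  obtain ⟨g, hg, hgB⟩ := exists_injective_forall_mem (fun j : ι × ULift.{u} Bool => B j.1)
    (fun j => hcard.trans (hB j.1))
  refine ⟨range fun i => g (i, ⟨true⟩), fun i => ⟨⟨_, hgB (i, ⟨true⟩), i, rfl⟩,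
    ⟨_, hgB (i, ⟨false⟩), ?_⟩⟩⟩
  rintro ⟨k, hk⟩
  simpa using hg hk

/-! ### Cellular families and resolvability -/

section Topological

variable {X : Type u} [TopologicalSpace X]

/-- A property shared by some open subset of every non-empty open set is shared by all members of
some disjoint family of open sets with dense union. -/
theorem exists_cellular_dense {P : Set X → Prop}
    (hP : ∀ U : Set X, IsOpen U → U.Nonempty → ∃ V ⊆ U, IsOpen V ∧ V.Nonempty ∧ P V) :
    ∃ 𝒱 : Set (Set X), (∀ V ∈ 𝒱, IsOpen V ∧ V.Nonempty ∧ P V) ∧ 𝒱.PairwiseDisjoint id ∧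
      Dense (⋃₀ 𝒱) := by
  obtain ⟨𝒱, h𝒱⟩ := zorn_subset
    {𝒱 : Set (Set X) | (∀ V ∈ 𝒱, IsOpen V ∧ V.Nonempty ∧ P V) ∧ 𝒱.PairwiseDisjoint id} (by
      intro c hc hchain
      refine ⟨⋃₀ c, ⟨?_, ?_⟩, fun s hs => subset_sUnion_of_mem hs⟩
      · rintro V ⟨𝒲, h𝒲, hV⟩
        exact (hc h𝒲).1 V hV
      · exact (pairwiseDisjoint_sUnion hchain.directedOn).2 fun 𝒲 h𝒲 => (hc h𝒲).2)
  refine ⟨𝒱, h𝒱.prop.1, h𝒱.prop.2, ?_⟩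
  rw [dense_iff_inter_open]
  intro U hU hne
  by_contra hcon
  obtain ⟨V, hVU, hVo, hVne, hVP⟩ := hP U hU hne
  have hdisj : ∀ W ∈ 𝒱, Disjoint V W := by
    intro W hW
    rw [Set.disjoint_iff_inter_eq_empty, ← Set.not_nonempty_iff_eq_empty]
    rintro ⟨x, hxV, hxW⟩
    exact hcon ⟨x, hVU hxV, W, hW, hxW⟩
  have hmem : V ∈ 𝒱 := by
    refine h𝒱.le_of_ge (y := insert V 𝒱) ⟨?_, ?_⟩ (subset_insert _ _) (mem_insert _ _)
    · rintro W (rfl | hW)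
      · exact ⟨hVo, hVne, hVP⟩
      · exact h𝒱.prop.1 W hW
    · exact h𝒱.prop.2.insert fun W hW _ => hdisj W hW
  exact hVne.ne_empty (disjoint_self.1 (hdisj V hmem))

theorem aleph0_le_mk_of_isOpen [T1Space X] [PerfectSpace X] {U : Set X} (hU : IsOpen U)
    (hne : U.Nonempty) : ℵ₀ ≤ #U := by
  obtain ⟨x, hx⟩ := hne
  rw [aleph0_le_mk_iff, Set.infinite_coe_iff]
  exact infinite_of_mem_nhds x (hU.mem_nhds hx)

/-- Inside a compact set, closures of small open sets refine open sets. -/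
theorem exists_isOpen_closure_subset [T2Space X] {K W : Set X} (hK : IsCompact K) (hWK : W ⊆ K)
    (hW : IsOpen W) (hne : W.Nonempty) :
    ∃ V : Set X, IsOpen V ∧ V.Nonempty ∧ closure V ⊆ W := by
  obtain ⟨p, hp⟩ := hne
  obtain ⟨P, Q, hPo, hQo, hpP, hKQ, hPQ⟩ := SeparatedNhds.of_isCompact_isCompact
    (isCompact_singleton (x := p)) (hK.diff hW) (by simp [hp])
  refine ⟨P ∩ W, hPo.inter hW, ⟨p, hpP rfl, hp⟩, fun x hx => ?_⟩
  by_contra hxW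
  have hxK : x ∈ K := closure_minimal (inter_subset_right.trans hWK) hK.isClosed hx
  obtain ⟨y, hyQ, hyP, -⟩ := mem_closure_iff.1 hx Q hQo (hKQ ⟨hxK, hxW⟩)
  exact hPQ.le_bot ⟨hyP, hyQ⟩

/-- A non-empty open subset of a compact set in a crowded Hausdorff space contains a non-empty
resolvable open set. -/
theorem exists_resolvable_subset [T2Space X] [PerfectSpace X] {K U : Set X} (hK : IsCompact K)
    (hUK : U ⊆ K) (hU : IsOpen U) (hne : U.Nonempty) :
    ∃ V ⊆ U, IsOpen V ∧ V.Nonempty ∧ ∃ D : Set X, ∀ O ⊆ V, IsOpen O → O.Nonempty →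
      (O ∩ D).Nonempty ∧ (O \ D).Nonempty := by
  -- With `W` of least cardinality, every non-empty open subset of `W` has exactly `#W` points.
  obtain ⟨W, ⟨hWU, hWo, hWne⟩, hmin⟩ := exists_minimalFor_of_wellFoundedLT
    (fun W : Set X => W ⊆ U ∧ IsOpen W ∧ W.Nonempty) (fun W => #W) ⟨U, Subset.rfl, hU, hne⟩
  have hmin : ∀ O ⊆ W, IsOpen O → O.Nonempty → #W ≤ #O := fun O hOW hO hOne =>
    (le_total #O #W).elim (fun h => hmin ⟨hOW.trans hWU, hO, hOne⟩ h) id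
  obtain ⟨V, hVo, hVne, hVW⟩ := exists_isOpen_closure_subset hK (hWU.trans hUK) hWo hWne
  have hVW' : V ⊆ W := subset_closure.trans hVW
  have hinf : ℵ₀ ≤ #W := aleph0_le_mk_of_isOpen hWo hWne
  have hsep : ∀ x y : X, ∃ A B : Set X, IsOpen A ∧ IsOpen B ∧ x ∈ A ∧ (x ≠ y → y ∈ B) ∧
      Disjoint A B := by
    intro x y
    by_cases hxy : x = y
    · exact ⟨univ, ∅, isOpen_univ, isOpen_empty, mem_univ _, fun h => absurd hxy h, by simp⟩
    · obtain ⟨A, B, hA, hB, hxA, hyB, hAB⟩ := t2_separation hxy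
      exact ⟨A, B, hA, hB, hxA, fun _ => hyB, hAB⟩
  choose A B hAo hBo hxA hyB hAB using hsep
  have hcard : #(V × Finset W) ≤ #W := by
    have : Infinite W := by rwa [← aleph0_le_mk_iff]
    rw [mk_prod, lift_id, lift_id, mk_finset_of_infinite]
    exact mul_le_of_le hinf (mk_le_mk_of_subset hVW') le_rfl
  -- These sets form a base of `V` of size at most `#W`: given `p ∈ O`, finitely many `B p y` cover
  -- the compact set `closure V \ O`, and the matching `A p y` cut `V` down into `O`.
  let E : V × Finset W → Set X := fun i => V ∩ ⋂ y ∈ i.2, A i.1 y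
  obtain ⟨D, hD⟩ := exists_splitting_set E #W hinf hcard fun i => by
    refine hmin _ (inter_subset_left.trans hVW')
      (hVo.inter (isOpen_biInter_finset fun y _ => hAo _ _)) ⟨i.1, i.1.2, ?_⟩
    simp only [mem_iInter]
    exact fun y _ => hxA _ _
  refine ⟨V, hVW'.trans hWU, hVo, hVne, D, fun O hOV hO ⟨p, hp⟩ => ?_⟩
  have hL : IsCompact (closure V \ O) :=
    (hK.of_isClosed_subset isClosed_closure (hVW.trans (hWU.trans hUK))).diff hO
  obtain ⟨F, hF⟩ := hL.elim_finite_subcover (fun y : W => B p y) (fun y => hBo p y)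
    fun y hy => mem_iUnion.2 ⟨⟨y, hVW hy.1⟩, hyB _ _ fun h => hy.2 (h.subst (motive := (· ∈ O)) hp)⟩
  have hsub : E (⟨p, hOV hp⟩, F) ⊆ O := by
    rintro x ⟨hxV, hx⟩
    by_contra hxO
    obtain ⟨y, hyF, hy⟩ := mem_iUnion₂.1 (hF ⟨subset_closure hxV, hxO⟩)
    exact (hAB p y).le_bot ⟨mem_iInter₂.1 hx y hyF, hy⟩
  obtain ⟨h₁, h₂⟩ := hD (⟨p, hOV hp⟩, F)
  exact ⟨h₁.mono (inter_subset_inter_left _ hsub), h₂.mono (sdiff_subset_sdiff_left hsub)⟩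

/-- An open set all of whose non-empty open subsets contain a non-empty open subset of a compact
set is resolvable. -/
theorem exists_dense_codense_subset [T2Space X] [PerfectSpace X] {G : Set X}
    (hG : ∀ U ⊆ G, IsOpen U → U.Nonempty → ∃ V ⊆ U, IsOpen V ∧ V.Nonempty ∧
      ∃ K, IsCompact K ∧ V ⊆ K) :
    ∃ D ⊆ G, ∀ O ⊆ G, IsOpen O → O.Nonempty → (O ∩ D).Nonempty ∧ (O \ D).Nonempty := by
  obtain ⟨𝒱, h𝒱, hdisj, hdense⟩ := exists_cellular_dense
    -- The condition `O ⊆ G` makes the property vacuous off `G`, so the family can be dense in all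
    -- of `X`.
    (P := fun V : Set X => ∃ D : Set X, ∀ O ⊆ V, O ⊆ G → IsOpen O → O.Nonempty →
      (O ∩ D).Nonempty ∧ (O \ D).Nonempty) (fun U hU hne => by
        by_cases h : ∃ V ⊆ U, V ⊆ G ∧ IsOpen V ∧ V.Nonempty
        · obtain ⟨V, hVU, hVG, hVo, hVne⟩ := h
          obtain ⟨V', hV'V, hV'o, hV'ne, K, hK, hV'K⟩ := hG V hVG hVo hVne
          obtain ⟨V'', h₁, h₂, h₃, D, hD⟩ := exists_resolvable_subset hK hV'K hV'o hV'ne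
          exact ⟨V'', h₁.trans (hV'V.trans hVU), h₂, h₃, D, fun O hO _ => hD O hO⟩
        · exact ⟨U, Subset.rfl, hU, hne, ∅, fun O hOU hOG hO hOne =>
            absurd ⟨O, hOU, hOG, hO, hOne⟩ h⟩)
  choose! D hD using fun V hV => (h𝒱 V hV).2.2
  refine ⟨G ∩ ⋃ V ∈ 𝒱, V ∩ D V, inter_subset_left, fun O hOG hO hOne => ?_⟩
  obtain ⟨x, hxO, V, hV, hxV⟩ := hdense.inter_open_nonempty O hO hOne
  obtain ⟨⟨y, ⟨hyO, hyV⟩, hyD⟩, ⟨z, ⟨hzO, hzV⟩, hzD⟩⟩ := hD V hV (O ∩ V) inter_subset_right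
    (inter_subset_left.trans hOG) (hO.inter (h𝒱 V hV).1) ⟨x, hxO, hxV⟩
  refine ⟨⟨y, hyO, hOG hyO, mem_biUnion hV ⟨hyV, hyD⟩⟩, ⟨z, hzO, ?_⟩⟩
  rintro ⟨-, hz⟩
  obtain ⟨V', hV', hzV', hzD'⟩ := mem_iUnion₂.1 hz
  obtain rfl : V = V' := hdisj.elim_set hV hV' z hzV hzV'
  exact hzD hzD'

/-! ### Dense meager sets and countable cellularity -/

/-- In a densely `k`-separable space, every dense set contains countably many compact sets with
dense union. -/
theorem DenselyKSeparable.exists_isCompact (hX : DenselyKSeparable X) {D : Set X} (hD : Dense D) :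
    ∃ K : ℕ → Set X, (∀ n, IsCompact (K n)) ∧ (∀ n, K n ⊆ D) ∧ Dense (⋃ n, K n) := by
  obtain ⟨S, ⟨K, hK, rfl⟩, hS⟩ := hX D hD
  refine ⟨fun n => (↑) '' K n, fun n => (hK n).image continuous_subtype_val,
    fun n => by simp, ?_⟩
  rw [← image_iUnion]
  exact hD.denseRange_val.dense_image continuous_subtype_val hS

theorem isNowhereDense_of_forall {N C : Set X} (hC : IsClosed C) (hNC : N ⊆ C)
    (h : ∀ O ⊆ C, IsOpen O → O.Nonempty → ∃ V ⊆ O, IsOpen V ∧ V.Nonempty ∧ Disjoint V N) :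
    IsNowhereDense N := by
  rw [IsNowhereDense, ← Set.not_nonempty_iff_eq_empty]
  intro hne
  obtain ⟨V, hVO, hV, ⟨x, hx⟩, hVN⟩ := h _
    (interior_subset.trans (closure_minimal hNC hC)) isOpen_interior hne
  obtain ⟨y, hyV, hyN⟩ := mem_closure_iff.1 (interior_subset (hVO hx)) V hV hx
  exact hVN.le_bot ⟨hyV, hyN⟩

/-- A densely `k`-separable crowded Hausdorff space has a dense meager subset. -/
theorem DenselyKSeparable.exists_isNowhereDense [T2Space X] [PerfectSpace X]
    (hX : DenselyKSeparable X) :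
    ∃ N : ℕ → Set X, (∀ n, IsNowhereDense (N n)) ∧ Dense (⋃ n, N n) := by
  obtain ⟨K, hK, -, hKd⟩ := hX.exists_isCompact dense_univ
  let G : Set X := ⋃ n, interior (K n)
  have hGo : IsOpen G := isOpen_iUnion fun n => isOpen_interior
  obtain ⟨D₀, hD₀G, hD₀⟩ := exists_dense_codense_subset (G := G) (fun U hUG hU ⟨x, hx⟩ => by
    obtain ⟨n, hn⟩ := mem_iUnion.1 (hUG hx)
    exact ⟨U ∩ interior (K n), inter_subset_left, hU.inter isOpen_interior, ⟨x, hx, hn⟩, K n, hK n,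
      inter_subset_right.trans interior_subset⟩)
  have hD : Dense (D₀ ∪ (closure G)ᶜ) := by
    rw [dense_iff_inter_open]
    intro O hO hne
    by_cases h : (O ∩ G).Nonempty
    · obtain ⟨x, hx, hxD⟩ := (hD₀ _ inter_subset_right (hO.inter hGo) h).1
      exact ⟨x, hx.1, Or.inl hxD⟩
    · obtain ⟨x, hx⟩ := hne
      exact ⟨x, hx, Or.inr fun hxG => h (mem_closure_iff.1 hxG O hO hx)⟩
  obtain ⟨L, hL, hLD, hLd⟩ := hX.exists_isCompact hD
  -- An open subset of `K n` lies in `G`, and an open subset of `L n ∩ G` would lie in the codense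
  -- set `D₀`.
  refine ⟨fun n => (K n \ closure G) ∪ (L n ∩ G), fun n => ?_, ?_⟩
  · refine isNowhereDense_of_forall (C := K n ∪ L n) ((hK n).isClosed.union (hL n).isClosed)
      (union_subset_union sdiff_subset inter_subset_left) fun O hOC hO hne => ?_
    by_cases hOG : (O ∩ G).Nonempty
    · by_cases h : (O ∩ G) ⊆ L n
      · obtain ⟨x, hx, hxD⟩ := (hD₀ _ inter_subset_right (hO.inter hGo) hOG).2
        exact absurd (hLD n (h hx)) (by simpa [hxD] using subset_closure hx.2)
      · obtain ⟨x, hx, hxL⟩ := not_subset.1 h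
        refine ⟨(O ∩ G) \ L n, sdiff_subset.trans inter_subset_left,
          (hO.inter hGo).sdiff (hL n).isClosed, ⟨x, hx, hxL⟩, ?_⟩
        rw [Set.disjoint_left]
        rintro y ⟨⟨-, hyG⟩, hyL⟩ (hy | hy)
        · exact hy.2 (subset_closure hyG)
        · exact hyL hy.1
    · by_cases h : O ⊆ K n
      · obtain ⟨x, hx⟩ := hne
        exact absurd ⟨x, hx, mem_iUnion.2 ⟨n, interior_maximal h hO hx⟩⟩ hOG
      · obtain ⟨x, hx, hxK⟩ := not_subset.1 h
        refine ⟨O \ K n, sdiff_subset, hO.sdiff (hK n).isClosed, ⟨x, hx, hxK⟩, ?_⟩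
        rw [Set.disjoint_left]
        rintro y ⟨hyO, hyK⟩ (hy | hy)
        · exact hyK hy.1
        · exact hOG ⟨y, hyO, hy.2⟩
  · rw [dense_iff_inter_open]
    intro O hO hne
    by_cases hOG : (O ∩ G).Nonempty
    · obtain ⟨x, ⟨hxO, hxG⟩, hx⟩ := hLd.inter_open_nonempty _ (hO.inter hGo) hOG
      obtain ⟨n, hn⟩ := mem_iUnion.1 hx
      exact ⟨x, hxO, mem_iUnion.2 ⟨n, Or.inr ⟨hn, hxG⟩⟩⟩
    · obtain ⟨x, hxO, hx⟩ := hKd.inter_open_nonempty _ hO hne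
      obtain ⟨n, hn⟩ := mem_iUnion.1 hx
      exact ⟨x, hxO, mem_iUnion.2 ⟨n, Or.inl ⟨hn, fun hxG =>
        hOG (mem_closure_iff.1 hxG O hO hxO)⟩⟩⟩

/-- Disjoint families of open sets with dense union are countable. -/
theorem DenselyKSeparable.countable_of_pairwiseDisjoint (hX : DenselyKSeparable X)
    {𝒱 : Set (Set X)} (ho : ∀ V ∈ 𝒱, IsOpen V) (hne : ∀ V ∈ 𝒱, V.Nonempty)
    (hdisj : 𝒱.PairwiseDisjoint id) (hd : Dense (⋃₀ 𝒱)) : 𝒱.Countable := by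
  -- A compact subset of `⋃₀ 𝒱` meets only finitely many members, while the dense union of the `K n`
  -- meets all.
  obtain ⟨K, hK, hKD, hKd⟩ := hX.exists_isCompact hd
  have hfin : ∀ n, ∃ ℱ ⊆ 𝒱, ℱ.Finite ∧ K n ⊆ ⋃₀ ℱ := fun n => by
    obtain ⟨ℱ, h₁, h₂, h₃⟩ := (hK n).elim_finite_subcover_image (c := id) ho
      (by simpa [sUnion_eq_biUnion] using hKD n)
    exact ⟨ℱ, h₁, h₂, by simpa [sUnion_eq_biUnion] using h₃⟩
  choose ℱ hℱ𝒱 hℱfin hKℱ using hfin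
  refine (countable_iUnion fun n => (hℱfin n).countable).mono fun V hV => ?_
  obtain ⟨x, hxV, hx⟩ := hKd.inter_open_nonempty V (ho V hV) (hne V hV)
  obtain ⟨n, hn⟩ := mem_iUnion.1 hx
  obtain ⟨W, hW, hxW⟩ := hKℱ n hn
  obtain rfl : V = W := hdisj.elim_set hV (hℱ𝒱 n hW) x hxV hxW
  exact mem_iUnion.2 ⟨n, hW⟩

/-! ### Shattering families -/

theorem subset_closure_of_forall_eq {𝒱 : Set (Set X)} (hd : Dense (⋃₀ 𝒱)) {O V : Set X}
    (hO : IsOpen O) (h : ∀ W ∈ 𝒱, (O ∩ W).Nonempty → W = V) : O ⊆ closure V := by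
  intro x hx
  rw [mem_closure_iff]
  intro Q hQ hxQ
  obtain ⟨y, ⟨hyO, hyQ⟩, W, hW, hyW⟩ := hd.inter_open_nonempty _ (hO.inter hQ) ⟨x, hx, hxQ⟩
  exact ⟨y, hyQ, h W hW ⟨y, hyO, hyW⟩ ▸ hyW⟩

theorem disjoint_interior_closure {A B : Set X} (hA : IsOpen A)
    (h : Disjoint A B) : Disjoint (interior (closure A)) (interior (closure B)) :=
  ((h.closure_right hA).mono_right interior_subset).closure_left isOpen_interior |>.mono_left
    interior_subset

theorem IsOpen.interior_closure_mem_regularOpens {A : Set X} (hA : IsOpen A) (hne : A.Nonempty) :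
    interior (closure A) ∈ regularOpens X :=
  ⟨interior_closure_idem, hne.mono (interior_maximal subset_closure hA)⟩

/-- No finite collection of disjoint families of open sets is shattering. -/
theorem IsShatteringFamily.infinite [Nonempty X] {𝔉 : Set (Set (Set X))}
    (h𝔉 : IsShatteringFamily 𝔉) : 𝔉.Infinite := by
  intro hfin
  have key : ∀ 𝔊 : Set (Set (Set X)), 𝔊.Finite → 𝔊 ⊆ 𝔉 → ∃ U : Set X, IsOpen U ∧ U.Nonempty ∧
      ∀ 𝒮 ∈ 𝔊, ∀ S ∈ 𝒮, ∀ T ∈ 𝒮, (U ∩ S).Nonempty → (U ∩ T).Nonempty → S = T := by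
    intro 𝔊 h𝔊
    induction 𝔊, h𝔊 using Set.Finite.induction_on with
    | empty => exact fun _ => ⟨univ, isOpen_univ, univ_nonempty, by simp⟩
    | @insert 𝒮 𝔊 _ _ ih =>
      intro hsub
      obtain ⟨U, hU, hne, h⟩ := ih ((subset_insert _ _).trans hsub)
      obtain ⟨hreg, hdisj⟩ := h𝔉.1 (hsub (mem_insert _ _))
      -- Shrinking `U` into one member of `𝒮` makes it miss the others.
      by_cases hmeet : ∃ S ∈ 𝒮, (U ∩ S).Nonempty
      · obtain ⟨S, hS, hUS⟩ := hmeet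
        have hSo : IsOpen S := (hreg hS).1 ▸ isOpen_interior
        refine ⟨U ∩ S, hU.inter hSo, hUS, ?_⟩
        rintro 𝒯 (rfl | h𝒯) A hA B hB hUA hUB
        · have hS' : ∀ C ∈ 𝒯, (U ∩ S ∩ C).Nonempty → C = S := fun C hC ⟨x, hx, hxC⟩ =>
            hdisj.elim_set hC hS x hxC hx.2
          rw [hS' A hA hUA, hS' B hB hUB]
        · exact h 𝒯 h𝒯 A hA B hB (hUA.mono (inter_subset_inter_left _ inter_subset_left))
            (hUB.mono (inter_subset_inter_left _ inter_subset_left))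
      · refine ⟨U, hU, hne, ?_⟩
        rintro 𝒯 (rfl | h𝒯) A hA B hB hUA hUB
        · exact absurd ⟨A, hA, hUA⟩ hmeet
        · exact h 𝒯 h𝒯 A hA B hB hUA hUB
  obtain ⟨U, hU, hne, h⟩ := key 𝔉 hfin Subset.rfl
  obtain ⟨𝒮, h𝒮, S, hS, T, hT, hST, hUS, hUT⟩ := h𝔉.2 U hU hne
  exact hST (h 𝒮 h𝒮 S hS T hT hUS hUT)

theorem DenselyKSeparable.exists_countable_shattering [T2Space X] [PerfectSpace X]
    (hX : DenselyKSeparable X) (hπ : PiRegular X) :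
    ∃ 𝔉 : Set (Set (Set X)), IsShatteringFamily 𝔉 ∧ 𝔉.Countable := by
  obtain ⟨N, hN, hNd⟩ := hX.exists_isNowhereDense
  have hfam : ∀ n, ∃ 𝒱 : Set (Set X), (∀ V ∈ 𝒱, IsOpen V ∧ V.Nonempty ∧ Disjoint (closure V) (N n)) ∧
      𝒱.PairwiseDisjoint id ∧ Dense (⋃₀ 𝒱) := fun n =>
    exists_cellular_dense fun U hU hne => by
      obtain ⟨x, hxU, hx⟩ := (interior_eq_empty_iff_dense_compl.1 (hN n)).inter_open_nonempty U hU hne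
      obtain ⟨V, hV, hVne, hVsub⟩ := hπ (U \ closure (N n)) (hU.sdiff isClosed_closure) ⟨x, hxU, hx⟩
      exact ⟨V, subset_closure.trans (hVsub.trans sdiff_subset), hV, hVne,
        (disjoint_sdiff_left.mono_left hVsub).mono_right subset_closure⟩
  choose 𝒱 h𝒱 hdisj hd using hfam
  refine ⟨range fun n => (fun V => interior (closure V)) '' 𝒱 n, ⟨?_, fun U hU hne => ?_⟩,
    countable_range _⟩
  · rintro _ ⟨n, rfl⟩
    refine ⟨?_, ?_⟩
    · rintro _ ⟨V, hV, rfl⟩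
      exact (h𝒱 n V hV).1.interior_closure_mem_regularOpens (h𝒱 n V hV).2.1
    · rintro _ ⟨V, hV, rfl⟩ _ ⟨W, hW, rfl⟩ hVW
      exact disjoint_interior_closure (h𝒱 n V hV).1
        (hdisj n hV hW fun h => hVW (by rw [h]))
  · by_contra hcon
    obtain ⟨x, hxU, hx⟩ := hNd.inter_open_nonempty U hU hne
    obtain ⟨n, hxn⟩ := mem_iUnion.1 hx
    obtain ⟨y, hyU, V, hV, hyV⟩ := (hd n).inter_open_nonempty U hU hne
    refine (h𝒱 n V hV).2.2.le_bot ⟨subset_closure_of_forall_eq (hd n) hU ?_ hxU, hxn⟩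
    rintro W hW ⟨z, hzU, hzW⟩
    by_contra hWV
    have hsub : ∀ V ∈ 𝒱 n, V ⊆ interior (closure V) := fun V hV =>
      interior_maximal subset_closure (h𝒱 n V hV).1
    refine hcon ⟨_, ⟨n, rfl⟩, interior (closure W), ⟨W, hW, rfl⟩, interior (closure V), ⟨V, hV, rfl⟩,
      fun h => ?_, ⟨z, hzU, hsub W hW hzW⟩, ⟨y, hyU, hsub V hV hyV⟩⟩
    have := disjoint_interior_closure (h𝒱 n W hW).1 (hdisj n hW hV hWV)
    exact this.le_bot ⟨hsub W hW hzW, h.subset (hsub W hW hzW)⟩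

theorem DenselyKSeparable.shatteringNumber_eq [T2Space X] [PerfectSpace X] [Nonempty X]
    (hX : DenselyKSeparable X) (hπ : PiRegular X) : shatteringNumber X = ℵ₀ := by
  obtain ⟨𝔉, h𝔉, hcount⟩ := hX.exists_countable_shattering hπ
  refine le_antisymm (le_trans (csInf_le' (a := #𝔉) ⟨𝔉, h𝔉, rfl⟩) hcount.le_aleph0)
    (le_csInf ⟨#𝔉, 𝔉, h𝔉, rfl⟩ ?_)
  rintro _ ⟨𝔊, h𝔊, rfl⟩
  rw [aleph0_le_mk_iff, Set.infinite_coe_iff]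
  exact h𝔊.infinite

/-! ### Nowhere constant images -/

/-- There is a countable set of continuous functions into the unit interval that are not
simultaneously constant on any non-empty open set. -/
theorem DenselyKSeparable.exists_countable_nowhereConstant [T2Space X] [PerfectSpace X]
    [CompletelyRegularSpace X] (hX : DenselyKSeparable X) :
    ∃ F : Set (X → unitInterval), F.Countable ∧ (∀ f ∈ F, Continuous f) ∧
      ∀ U : Set X, IsOpen U → U.Nonempty → ∃ f ∈ F, (f '' U).Nontrivial := by
  obtain ⟨N, hN, hNd⟩ := hX.exists_isNowhereDense
  have hfam : ∀ n, ∃ 𝒱 : Set (Set X), (∀ V ∈ 𝒱, IsOpen V ∧ V.Nonempty ∧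
      ∃ f : X → unitInterval, Continuous f ∧ V = {x | f x ≠ 1} ∧ Disjoint V (N n)) ∧
      𝒱.PairwiseDisjoint id ∧ Dense (⋃₀ 𝒱) := fun n =>
    exists_cellular_dense fun U hU hne => by
      obtain ⟨x, hxU, hx⟩ := (interior_eq_empty_iff_dense_compl.1 (hN n)).inter_open_nonempty U hU hne
      obtain ⟨f, hf, hfx, hf1⟩ := CompletelyRegularSpace.completely_regular x (U \ closure (N n))ᶜ
        (hU.sdiff isClosed_closure).isClosed_compl (fun h => h ⟨hxU, hx⟩)
      have hsub : {y | f y ≠ 1} ⊆ U \ closure (N n) := fun y hy => by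
        by_contra h
        exact hy (hf1 h)
      refine ⟨{y | f y ≠ 1}, hsub.trans sdiff_subset, isOpen_ne_fun hf continuous_const,
        ⟨x, by simp [hfx]⟩, f, hf, rfl, ?_⟩
      exact (disjoint_sdiff_left.mono_left hsub).mono_right subset_closure
  choose 𝒱 h𝒱 hdisj hd using hfam
  choose! f hf hfV hVN using fun n V hV => (h𝒱 n V hV).2.2
  have hcount : ∀ n, (𝒱 n).Countable := fun n =>
    hX.countable_of_pairwiseDisjoint (fun V hV => (h𝒱 n V hV).1) (fun V hV => (h𝒱 n V hV).2.1)
      (hdisj n) (hd n)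
  refine ⟨⋃ n, f n '' 𝒱 n, countable_iUnion fun n => (hcount n).image _, ?_, fun U hU hne => ?_⟩
  · intro g hg
    obtain ⟨n, V, hV, rfl⟩ := mem_iUnion.1 hg
    exact hf n V hV
  · obtain ⟨x, hxU, hx⟩ := hNd.inter_open_nonempty U hU hne
    obtain ⟨n, hxn⟩ := mem_iUnion.1 hx
    obtain ⟨y, hyU, V, hV, hyV⟩ := (hd n).inter_open_nonempty U hU hne
    refine ⟨f n V, mem_iUnion.2 ⟨n, V, hV, rfl⟩, f n V x, ⟨x, hxU, rfl⟩, f n V y, ⟨y, hyU, rfl⟩, ?_⟩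
    -- The function of `V` equals 1 at `x`, off `V`, but not at `y ∈ V`.
    have hxV : x ∉ V := fun h => (hVN n V hV).le_bot ⟨h, hxn⟩
    rw [hfV n V hV] at hxV hyV
    simp only [mem_ofPred_eq, not_not] at hxV
    rw [hxV]
    exact hyV.symm

/-- Continuous metrizable images of pseudocompact spaces are closed. -/
theorem Pseudocompact.isClosed_range (hX : Pseudocompact X) {Z : Type*} [TopologicalSpace Z]
    [TopologicalSpace.MetrizableSpace Z] {f : X → Z} (hf : Continuous f) : IsClosed (range f) := by
  let := TopologicalSpace.metrizableSpaceMetric Z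
  refine isClosed_of_closure_subset fun z hz => ?_
  by_contra hzr
  have hpos : ∀ x, 0 < dist (f x) z := fun x => dist_pos.2 fun h => hzr ⟨x, h⟩
  -- The inverse distance to a missing limit point `z` would be continuous and unbounded.
  obtain ⟨C, hC⟩ := (hX (fun x => (dist (f x) z)⁻¹)
    ((hf.dist continuous_const).inv₀ fun x => (hpos x).ne')).exists_norm_le
  have hC' : ∀ x, (dist (f x) z)⁻¹ ≤ C := fun x => (le_abs_self _).trans (hC _ ⟨x, rfl⟩)
  obtain ⟨_, ⟨x, rfl⟩, hx⟩ := Metric.mem_closure_iff.1 hz (|C| + 1)⁻¹ (by positivity)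
  rw [dist_comm] at hx
  have := (lt_inv_comm₀ (hpos x) (by positivity)).1 hx
  linarith [hC' x, le_abs_self C]

/-- The fibre over an isolated point would be a non-empty open set on which `f` is constant. -/
theorem IsNowhereConstant.perfectSpace {Y : Type u} [TopologicalSpace Y] {f : X → Y}
    (hf : IsNowhereConstant f) (hsurj : Function.Surjective f) : PerfectSpace Y := by
  rw [perfectSpace_iff_forall_not_isolated]
  intro y
  by_contra h
  rw [Filter.not_neBot, ← isOpen_singleton_iff_punctured_nhds] at h
  obtain ⟨x, rfl⟩ := hsurj y
  exact Set.not_nontrivial_iff.2 ((subsingleton_singleton (a := f x)).anti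
    (image_preimage_subset _ _)) (hf.2 _ (h.preimage hf.1) ⟨x, rfl⟩)

theorem DenselyKSeparable.exists_nowhereConstant_image [T2Space X] [PerfectSpace X]
    [CompletelyRegularSpace X] (hX : DenselyKSeparable X) (hps : Pseudocompact X) :
    ∃ (Y : Type u) (_ : TopologicalSpace Y) (f : X → Y),
      CompactSpace Y ∧ TopologicalSpace.MetrizableSpace Y ∧ PerfectSpace Y ∧
        Function.Surjective f ∧ IsNowhereConstant f := by
  obtain ⟨F, hFc, hF, hFne⟩ := hX.exists_countable_nowhereConstant
  have : Countable F := hFc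
  let e : X → F → unitInterval := fun x f => f.1 x
  have he : Continuous e := continuous_pi fun f => hF f.1 f.2
  have hsurj : Function.Surjective (rangeFactorization e) := rangeFactorization_surjective
  have hnc : IsNowhereConstant (rangeFactorization e) := by
    refine ⟨he.subtype_mk _, fun U hU hne => ?_⟩
    obtain ⟨f, hfF, hf⟩ := hFne U hU hne
    obtain ⟨_, ⟨x, hx, rfl⟩, _, ⟨y, hy, rfl⟩, hxy⟩ := hf
    exact ⟨_, ⟨x, hx, rfl⟩, _, ⟨y, hy, rfl⟩, fun h =>
      hxy (congrFun (congrArg Subtype.val h) ⟨f, hfF⟩)⟩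
  exact ⟨range e, inferInstance, rangeFactorization e,
    isCompact_iff_compactSpace.1 (hps.isClosed_range he).isCompact, inferInstance,
    hnc.perfectSpace hsurj, hsurj, hnc⟩

end Topological

theorem mainTheorem12 (X : Type u) [TopologicalSpace X] [T2Space X] [PerfectSpace X]
    (hX : DenselyKSeparable X) :
    (Nonempty X → FeeblyCompact X → PiRegular X → shatteringNumber X = ℵ₀) ∧
    (CompletelyRegularSpace X → Pseudocompact X →
      ∃ (Y : Type u) (_ : TopologicalSpace Y) (f : X → Y),
        CompactSpace Y ∧ TopologicalSpace.MetrizableSpace Y ∧ PerfectSpace Y ∧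
          Function.Surjective f ∧ IsNowhereConstant f) :=
  ⟨fun _ _ hπ => hX.shatteringNumber_eq hπ, fun _ hps => hX.exists_nowhereConstant_image hps⟩
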